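/- Let $n\ge 2$. Let $S_n$ be the group of permutations of $\{1,\dots,n\}$ and let $\ell$ be its length function with respect to the simple transpositions $(i\;\,i+1)$, $1\le i<n$. Let $S_n^B$ be the group of bijections $\sigma$ of $\{-n,\dots,-1,1,\dots,n\}$ such that $\sigma(-a)=-\sigma(a)$ for all $a$, and let $\ell_B$ be its length function with respect to the Coxeter generators $s_0,s_1,\dots,s_{n-1}$, where $s_0$ exchanges $1$ and $-1$, and $s_i$ ($1\le i<n$) exchanges $i$ with $i+1$ and $-i$ with $-(i+1)$. For $\sigma$ in $S_n$ or in $S_n^B$ let $$\mathrm{maj}(\sigma)=\sum_{1\le i<n,\ \sigma(i)>\sigma(i+1)} i ,$$ and for $\sigma\in S_n^B$ let $$\mathrm{nmaj}(\sigma)=\mathrm{maj}(\sigma)-\sum_{1\le i\le n,\ \sigma(i)<0}\sigma(i).$$ Write $\mathrm{Im}(f)$ for the set of values of a function $f$. Then, for $\ell_B$ and $\mathrm{nmaj}$ as functions on $S_n^B$, $$|\mathrm{Im}(\ell_B+\mathrm{nmaj})|=\begin{cases}5,&\text{if } n=2;\\ 2n^2-1,&\text{if } n>2,\end{cases}$$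 and $\mathrm{Im}(\ell_B-\mathrm{nmaj})=\mathrm{Im}(\ell-\mathrm{maj})$, where $\ell-\mathrm{maj}$ is taken on $S_n$. -/

import Mathlib

namespace CoxeterStat

/-- The length of `w` with respect to a set `S` of generators of the group `G` (for a Coxeter
system: the Coxeter length): the least number of factors in an expression of `w` as a product of
elements of `S`. -/
noncomputable def wordLength {G : Type*} [Group G] (S : Set G) (w : G) : ℕ :=
  sInf {k : ℕ | ∃ l : List G, (∀ s ∈ l, s ∈ S) ∧ l.prod = w ∧ l.length = k}

/-! ### Statistics of finite integer sequences

A sequence `(a₁, …, aₙ)` is a function `a : Fin n → ℤ`; the term `aₖ₊₁` is `a k`. -/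

/-- `(i, j)` is an inversion of `a`. -/
def IsInversion {n : ℕ} (a : Fin n → ℤ) (i j : Fin n) : Prop := i < j ∧ a j < a i

/-- The position `i` is a descent of `a`: the pair formed by `i` and the next position is an
inversion. -/
def IsDescent {n : ℕ} (a : Fin n → ℤ) (i : Fin n) : Prop :=
  ∃ j : Fin n, (j : ℕ) = (i : ℕ) + 1 ∧ IsInversion a i j

open Classical in
/-- The major index: the sum of the descents, positions being counted from `1`. -/
noncomputable def maj {n : ℕ} (a : Fin n → ℤ) : ℤ :=
  ∑ i : Fin n with IsDescent a i, (((i : ℕ) : ℤ) + 1)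

/-- The sum of the negative terms of a sequence. -/
def negSum {n : ℕ} (a : Fin n → ℤ) : ℤ := ∑ i : Fin n with a i < 0, a i

/-! ### The symmetric group

`Equiv.Perm (Fin n)` is the group of permutations of `{1, …, n}`, where `k : Fin n` stands for
`k + 1`. -/

/-- The sequence `(σ(1), …, σ(n))`. -/
def seqA {n : ℕ} (σ : Equiv.Perm (Fin n)) : Fin n → ℤ := fun i => ((σ i : ℕ) : ℤ) + 1

/-- The simple transpositions of the symmetric group. -/
def simpleA (n : ℕ) : Set (Equiv.Perm (Fin n)) :=
  {s | ∃ i j : Fin n, (j : ℕ) = (i : ℕ) + 1 ∧ s = Equiv.swap i j}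

/-- The length function of the symmetric group. -/
noncomputable def lenA (n : ℕ) (σ : Equiv.Perm (Fin n)) : ℤ := (wordLength (simpleA n) σ : ℤ)

/-- The major index on the symmetric group. -/
noncomputable def majA (n : ℕ) (σ : Equiv.Perm (Fin n)) : ℤ := maj (seqA σ)

/-! ### The hyperoctahedral group -/

/-- The set `[±n] = {-n, …, -1, 1, …, n}`. -/
abbrev PM (n : ℕ) : Type := {a : ℤ // a ≠ 0 ∧ |a| ≤ (n : ℤ)}

instance (n : ℕ) : InvolutiveNeg (PM n) where
  neg a := ⟨-a.1, neg_ne_zero.mpr a.2.1, by rw [abs_neg]; exact a.2.2⟩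
  neg_neg a := Subtype.ext (neg_neg a.1)

/-- The element `k + 1` of `[±n]`. -/
def pos {n : ℕ} (k : Fin n) : PM n :=
  ⟨((k : ℕ) : ℤ) + 1, by omega, by rw [abs_of_nonneg (by omega)]; omega⟩

/-- The group of the bijections `w` of `[±n]` with `w(-a) = -w(a)`. -/
def SB (n : ℕ) : Subgroup (Equiv.Perm (PM n)) where
  carrier := {w | ∀ a, w (-a) = -w a}
  one_mem' _ := rfl
  mul_mem' {u v} hu hv a := by
    rw [Equiv.Perm.mul_apply, hv a, hu (v a), Equiv.Perm.mul_apply]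
  inv_mem' {u} hu a := by
    rw [Equiv.Perm.inv_eq_iff_eq, hu, show u (u⁻¹ a) = a from Equiv.apply_symm_apply u a]

/-- The sequence `(σ(1), …, σ(n))` of a signed permutation. -/
def seqB {n : ℕ} (σ : SB n) : Fin n → ℤ := fun i => (σ.1 (pos i)).1

/-- The generators of the hyperoctahedral group: `s₀`, which exchanges `1` and `-1`, and `sᵢ` for
`1 ≤ i < n`, which exchanges `i` and `i + 1`, and `-i` and `-(i + 1)`. -/
def simpleB (n : ℕ) : Set (SB n) :=
  {s | (∃ i : Fin n, (i : ℕ) = 0 ∧ s.1 = Equiv.swap (pos i) (-pos i)) ∨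
    ∃ i j : Fin n, (j : ℕ) = (i : ℕ) + 1 ∧
      s.1 = Equiv.swap (pos i) (pos j) * Equiv.swap (-pos i) (-pos j)}

/-- The length function of the hyperoctahedral group with respect to its Coxeter generators. -/
noncomputable def lenB (n : ℕ) (σ : SB n) : ℤ := (wordLength (simpleB n) σ : ℤ)

/-- The negative major index: `nmaj(σ) = maj(σ) - ∑ σ(i)`, summed over the `i` with
`σ(i) < 0`. -/
noncomputable def nmaj (n : ℕ) (σ : SB n) : ℤ := maj (seqB σ) - negSum (seqB σ)

end CoxeterStat

namespace CoxeterStat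

/-! Both lengths are computed from the sequence of values: `lenA` is the number of inversions, and
`lenB` is the number of inversions minus the sum of the negative terms (`lenA_eq`, `lenB_eq`). In
`lenB - nmaj` the negative sum cancels, leaving inversions minus major index. This depends only on
the relative order of the terms, so standardization gives the image on the symmetric group.

In `lenB + nmaj` there remains `sumStat`: inversions plus major index minus twice the negative sum.
Negating a sequence replaces its value v by 2n² - v (`sumStat_neg`), so the image is a symmetric
subset of [0, 2n²]. The value 1 is impossible because inversions and major index vanish together; by
symmetry 2n² - 1 is impossible too. Increasing sequences give the even values up to n(n + 1), past
the midpoint n², and exchanging their second and third terms adds 3, which gives the odd values when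
n > 2. Symmetry supplies the rest. For n = 2, inversions plus major index is 0 or 2, so only even
values occur. -/

/-! ### Word length from a descent statistic -/

/-- A statistic that changes by at most one under right multiplication by a generator, and that
decreases for a suitable generator at each `w ≠ 1`, is the word length. -/
theorem wordLength_eq_of_descent {G : Type*} [Group G] (S : Set G) (f : G → ℤ)
    (hinv : ∀ s ∈ S, s * s = 1) (h1 : f 1 = 0) (h0 : ∀ w, 0 ≤ f w)
    (hle : ∀ w, ∀ s ∈ S, f (w * s) ≤ f w + 1)
    (hdesc : ∀ w, w ≠ 1 → ∃ s ∈ S, f (w * s) + 1 = f w) (w : G) :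
    (wordLength S w : ℤ) = f w := by
  have lower : ∀ l : List G, (∀ s ∈ l, s ∈ S) → f l.prod ≤ l.length := by
    intro l
    induction l using List.reverseRecOn with
    | nil => simp [h1]
    | append_singleton l s ih =>
      intro hl
      have h2 := ih fun t ht => hl t (by simp [ht])
      have h3 := hle l.prod s (hl s (by simp))
      simp only [List.prod_append, List.prod_cons, List.prod_nil, mul_one, List.length_append,
        List.length_cons, List.length_nil]
      push_cast
      linarith
  have upper : ∀ k : ℕ, ∀ w, f w = k → ∃ l : List G, (∀ s ∈ l, s ∈ S) ∧ l.prod = w ∧ l.length = k := by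
    intro k
    induction k with
    | zero =>
      intro w hw
      by_cases h : w = 1
      · exact ⟨[], by simp, by simp [h], rfl⟩
      -- A descent from value 0 would produce a negative value.
      · obtain ⟨s, -, hs⟩ := hdesc w h
        have := h0 (w * s)
        push_cast at hw
        omega
    | succ k ih =>
      intro w hw
      by_cases h : w = 1
      · rw [h, h1] at hw
        omega
      · obtain ⟨s, hsS, hs⟩ := hdesc w h
        obtain ⟨l, hl, hp, hk⟩ := ih (w * s) (by push_cast at hw; omega)
        refine ⟨l ++ [s], ?_, ?_, by simp [hk]⟩
        · intro t ht
          rcases List.mem_append.1 ht with ht | ht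
          · exact hl t ht
          · rw [List.mem_singleton.1 ht]
            exact hsS
        · rw [List.prod_append, hp, List.prod_singleton, mul_assoc, hinv s hsS, mul_one]
  obtain ⟨k, hk⟩ := Int.eq_ofNat_of_zero_le (h0 w)
  have hmem := upper k w hk
  have hinf : wordLength S w = k := by
    refine le_antisymm (Nat.sInf_le hmem) (le_csInf ⟨k, hmem⟩ ?_)
    rintro m ⟨l, hl, hp, hm⟩
    have := lower l hl
    rw [hp, hk, hm] at this
    exact_mod_cast this
  rw [hinf, hk]

/-! ### Inversions -/

/-- The number of inversions of a sequence. -/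
def invCount {n : ℕ} (a : Fin n → ℤ) : ℕ :=
  (Finset.univ.filter fun p : Fin n × Fin n => p.1 < p.2 ∧ a p.2 < a p.1).card

/-- No position lies strictly between two adjacent ones, so their exchange reverses no other pair.
-/
theorem swap_lt_swap_of_adjacent {n : ℕ} {i j p q : Fin n} (hij : (j : ℕ) = i + 1) (hpq : p < q)
    (hne : ¬(p = i ∧ q = j)) : Equiv.swap i j p < Equiv.swap i j q := by
  simp only [Equiv.swap_apply_def]
  simp only [Fin.ext_iff, Fin.lt_def] at *
  split_ifs <;> omega

/-- The exchange carries the old inversions bijectively onto the new ones other than `(i, j)`, which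
is the one gained. -/
theorem invCount_comp_swap {n : ℕ} (a : Fin n → ℤ) {i j : Fin n} (hij : (j : ℕ) = i + 1)
    (h : a i < a j) : invCount (a ∘ Equiv.swap i j) = invCount a + 1 := by
  set s := Equiv.swap i j with hs
  have hlt : i < j := by rw [Fin.lt_def]; omega
  have key : (Finset.univ.filter fun p : Fin n × Fin n =>
        p.1 < p.2 ∧ (a ∘ s) p.2 < (a ∘ s) p.1) =
      insert (i, j) ((Finset.univ.filter fun p : Fin n × Fin n =>
        p.1 < p.2 ∧ a p.2 < a p.1).map (Equiv.prodCongr s s).toEmbedding) := by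
    ext ⟨p, q⟩
    simp only [Finset.mem_filter, Finset.mem_univ, true_and, Finset.mem_insert,
      Finset.mem_map_equiv, Function.comp_apply, Prod.mk.injEq, Equiv.prodCongr_symm,
      Equiv.prodCongr_apply, Prod.map_apply, hs, Equiv.symm_swap]
    constructor
    · rintro ⟨h1, h2⟩
      by_cases hc : p = i ∧ q = j
      · exact Or.inl hc
      · exact Or.inr ⟨swap_lt_swap_of_adjacent hij h1 hc, h2⟩
    · rintro (⟨rfl, rfl⟩ | ⟨h1, h2⟩)
      · exact ⟨hlt, by simpa using h⟩
      · refine ⟨?_, h2⟩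
        have := swap_lt_swap_of_adjacent hij h1 ?_
        · simpa using this
        · rintro ⟨h3, h4⟩
          rw [h3, h4] at h2
          exact absurd h2 (not_lt.2 h.le)
  unfold invCount
  rw [key, Finset.card_insert_of_notMem, Finset.card_map]
  simp only [Finset.mem_filter, Finset.mem_univ, true_and, Finset.mem_map_equiv,
    Equiv.prodCongr_symm, Equiv.prodCongr_apply, Prod.map_apply, hs, Equiv.symm_swap,
    Equiv.swap_apply_left, Equiv.swap_apply_right]
  exact fun hc => absurd hc.1 (not_lt.2 hlt.le)

theorem invCount_comp_swap_of_gt {n : ℕ} (a : Fin n → ℤ) {i j : Fin n} (hij : (j : ℕ) = i + 1)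
    (h : a j < a i) : invCount (a ∘ Equiv.swap i j) + 1 = invCount a := by
  rw [← invCount_comp_swap (a ∘ Equiv.swap i j) hij (by simpa using h)]
  congr 1
  ext k
  simp

theorem add_le_of_adjacent_lt {n : ℕ} {a : Fin n → ℤ}
    (h : ∀ i j : Fin n, (j : ℕ) = i + 1 → a i < a j) {i j : Fin n} (hij : i ≤ j) :
    a i + ((j : ℕ) - (i : ℕ) : ℤ) ≤ a j := by
  have key : ∀ d : ℕ, ∀ i j : Fin n, (j : ℕ) = i + d → a i + d ≤ a j := by
    intro d
    induction d with
    | zero =>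
      intro i j hd
      rw [show j = i from Fin.ext hd]
      simp
    | succ d ih =>
      intro i j hd
      have h1 := ih i ⟨i + d, by omega⟩ rfl
      have h2 := h ⟨i + d, by omega⟩ j (by simp; omega)
      push_cast
      linarith
  have := key (j - i) i j (by rw [Fin.le_def] at hij; omega)
  rw [Fin.le_def] at hij
  push_cast [hij] at this
  exact this

theorem strictMono_of_adjacent_lt {n : ℕ} {a : Fin n → ℤ}
    (h : ∀ i j : Fin n, (j : ℕ) = i + 1 → a i < a j) : StrictMono a := by
  intro i j hij
  have := add_le_of_adjacent_lt h hij.le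
  rw [Fin.lt_def] at hij
  omega

/-- Integer steps of at least 1 between bounds 1 and n leave no slack. This identifies the identity
as the only element without a descent. -/
theorem eq_succ_of_adjacent_lt {n : ℕ} {a : Fin n → ℤ}
    (h : ∀ i j : Fin n, (j : ℕ) = i + 1 → a i < a j) (h1 : ∀ i, 1 ≤ a i) (hn : ∀ i, a i ≤ n)
    (i : Fin n) : a i = (i : ℕ) + 1 := by
  have hpos : 0 < n := i.pos
  have e1 := add_le_of_adjacent_lt h (i := ⟨0, hpos⟩) (j := i) (by simp [Fin.le_def])
  have e2 := add_le_of_adjacent_lt h (i := i) (j := ⟨n - 1, by omega⟩)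
    (by simp [Fin.le_def]; omega)
  have e3 := h1 ⟨0, hpos⟩
  have e4 := hn ⟨n - 1, by omega⟩
  simp only at e1 e2
  omega

/-- The number of inversions depends on the relative order of the terms only. -/
theorem invCount_congr {n : ℕ} {a b : Fin n → ℤ} (h : ∀ i j, a i < a j ↔ b i < b j) :
    invCount a = invCount b := by
  simp only [invCount, h]

theorem maj_congr {n : ℕ} {a b : Fin n → ℤ} (h : ∀ i j, a i < a j ↔ b i < b j) :
    maj a = maj b := by
  have : IsDescent a = IsDescent b := by
    ext i
    simp only [IsDescent, IsInversion, h]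
  rw [maj, maj, this]

theorem invCount_eq_zero {n : ℕ} {a : Fin n → ℤ} (h : StrictMono a) : invCount a = 0 := by
  rw [invCount, Finset.card_eq_zero, Finset.filter_eq_empty_iff]
  rintro ⟨i, j⟩ - ⟨h1, h2⟩
  exact absurd h2 (not_lt.2 (h h1).le)

theorem maj_eq_zero_of_invCount_eq_zero {n : ℕ} {a : Fin n → ℤ} (h : invCount a = 0) :
    maj a = 0 := by
  classical
  rw [invCount, Finset.card_eq_zero, Finset.filter_eq_empty_iff] at h
  apply Finset.sum_eq_zero
  intro i hi
  obtain ⟨j, -, hj⟩ := (Finset.mem_filter.1 hi).2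
  exact absurd hj (@h (i, j) (Finset.mem_univ _))

theorem maj_nonneg {n : ℕ} (a : Fin n → ℤ) : 0 ≤ maj a :=
  Finset.sum_nonneg fun _ _ => by positivity

theorem invCount_eq_zero_of_maj_eq_zero {n : ℕ} {a : Fin n → ℤ} (ha : Function.Injective a)
    (h : maj a = 0) : invCount a = 0 := by
  classical
  refine invCount_eq_zero (strictMono_of_adjacent_lt fun i j hij => ?_)
  have h1 := (Finset.sum_eq_zero_iff_of_nonneg fun _ _ => by positivity).1 h i
  by_contra hc
  have hne : a j ≠ a i := fun he => by
    have := ha he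
    rw [Fin.ext_iff] at this
    omega
  have := h1 (Finset.mem_filter.2 ⟨Finset.mem_univ _, j, hij, by rw [Fin.lt_def]; omega,
    lt_of_le_of_ne (not_lt.1 hc) hne⟩)
  omega

/-- Each of the two summands vanishes exactly when the sequence is increasing, so the sum is 0 or at
least 2. -/
theorem invCount_add_maj_ne_one {n : ℕ} {a : Fin n → ℤ} (ha : Function.Injective a) :
    (invCount a : ℤ) + maj a ≠ 1 := by
  intro h
  have h0 := maj_nonneg a
  by_cases h1 : invCount a = 0
  · have := maj_eq_zero_of_invCount_eq_zero h1
    omega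
  · have := invCount_eq_zero_of_maj_eq_zero ha (by omega)
    omega

theorem two_mul_sum_fin_succ (n : ℕ) : 2 * ∑ i : Fin n, (((i : ℕ) : ℤ) + 1) = n * (n + 1) := by
  induction n with
  | zero => simp
  | succ n ih =>
    rw [Fin.sum_univ_castSucc, mul_add]
    simp only [Fin.val_castSucc, Fin.val_last, ih]
    push_cast
    ring

/-- Each pair of positions is an inversion of exactly one of `a` and `-a`. -/
theorem two_mul_invCount_add_neg {n : ℕ} {a : Fin n → ℤ} (ha : Function.Injective a) :
    2 * ((invCount a : ℤ) + invCount (-a)) = n * (n - 1) := by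
  have h1 : invCount a + invCount (-a) =
      (Finset.univ.filter fun p : Fin n × Fin n => p.1 < p.2).card := by
    rw [← Finset.card_filter_add_card_filter_not (s := Finset.univ.filter
      fun p : Fin n × Fin n => p.1 < p.2) (fun p => a p.2 < a p.1), Finset.filter_filter,
      Finset.filter_filter]
    unfold invCount
    congr 2
    ext ⟨i, j⟩
    simp only [Finset.mem_filter, Finset.mem_univ, true_and, Pi.neg_apply, neg_lt_neg_iff, not_lt]
    refine and_congr_right fun hij => ⟨le_of_lt, fun h => lt_of_le_of_ne h fun he => ?_⟩
    exact hij.ne (ha he)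
  have h2 : (Finset.univ.filter fun p : Fin n × Fin n => p.1 < p.2).card =
      (Finset.univ.filter fun p : Fin n × Fin n => p.2 < p.1).card :=
    Finset.card_bij' (fun p _ => p.swap) (fun p _ => p.swap) (by simp) (by simp) (by simp)
      (by simp)
  have h3 : (Finset.univ.filter fun p : Fin n × Fin n => p.1 < p.2).card =
      ∑ i : Fin n, (i : ℕ) := by
    rw [h2, Finset.card_filter, ← Finset.univ_product_univ, Finset.sum_product]
    refine Finset.sum_congr rfl fun i _ => ?_
    rw [← Finset.card_filter, ← Fin.card_Iio]
    congr 1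
    ext j
    simp
  have h4 := two_mul_sum_fin_succ n
  rw [Finset.sum_add_distrib] at h4
  simp only [Finset.sum_const, Finset.card_univ, Fintype.card_fin, nsmul_eq_mul, mul_one] at h4
  have h5 : (invCount a : ℤ) + invCount (-a) = ∑ i : Fin n, ((i : ℕ) : ℤ) := by
    rw [← Nat.cast_add, h1, h3]
    push_cast
    rfl
  rw [h5]
  linarith

theorem two_mul_maj_add_neg {n : ℕ} {a : Fin n → ℤ} (ha : Function.Injective a) :
    2 * (maj a + maj (-a)) = n * (n - 1) := by
  classical
  cases n with
  | zero => simp [maj]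
  | succ n =>
    -- The last position has no successor, hence is never a descent and drops out of the sum.
    have hs : ∀ b : Fin (n + 1) → ℤ, maj b =
        ∑ i : Fin n, if b i.succ < b i.castSucc then (((i : ℕ) : ℤ) + 1) else 0 := by
      intro b
      rw [maj, Finset.sum_filter, Fin.sum_univ_castSucc, if_neg, add_zero]
      · refine Finset.sum_congr rfl fun i _ => ?_
        have : IsDescent b i.castSucc ↔ b i.succ < b i.castSucc := by
          constructor
          · rintro ⟨j, hj, -, h⟩
            rwa [show j = i.succ from Fin.ext (by simpa using hj)] at h
          · exact fun h => ⟨i.succ, by simp, Fin.castSucc_lt_succ, h⟩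
        simp only [this, Fin.val_castSucc]
      · rintro ⟨j, hj, -⟩
        simp only [Fin.val_last] at hj
        omega
    have : maj a + maj (-a) = ∑ i : Fin n, (((i : ℕ) : ℤ) + 1) := by
      rw [hs, hs, ← Finset.sum_add_distrib]
      refine Finset.sum_congr rfl fun i _ => ?_
      have hne : a i.succ ≠ a i.castSucc := fun h => (Fin.castSucc_lt_succ (i := i)).ne' (ha h)
      simp only [Pi.neg_apply, neg_lt_neg_iff]
      rcases lt_or_gt_of_ne hne with h | h
      · simp [h, not_lt.2 h.le]
      · simp [h, not_lt.2 h.le]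
    rw [this, two_mul_sum_fin_succ]
    push_cast
    ring

/-! ### Signed sequences -/

/-- The sequences whose absolute values are a rearrangement of `1, …, n`. -/
structure IsSigned {n : ℕ} (a : Fin n → ℤ) : Prop where
  one_le : ∀ i, 1 ≤ |a i|
  le : ∀ i, |a i| ≤ n
  abs_injective : Function.Injective fun i => |a i|

namespace IsSigned

variable {n : ℕ} {a : Fin n → ℤ}

theorem injective (ha : IsSigned a) : Function.Injective a := fun _ _ h =>
  ha.abs_injective (congrArg abs h)

theorem ne_zero (ha : IsSigned a) (i : Fin n) : a i ≠ 0 := abs_pos.1 (ha.one_le i)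

theorem image_abs (ha : IsSigned a) :
    Finset.univ.image (fun i => |a i|) = Finset.Icc (1 : ℤ) n := by
  refine Finset.eq_of_subset_of_card_le ?_ ?_
  · intro x hx
    obtain ⟨i, -, rfl⟩ := Finset.mem_image.1 hx
    exact Finset.mem_Icc.2 ⟨ha.one_le i, ha.le i⟩
  · rw [Finset.card_image_of_injective _ ha.abs_injective]
    simp

theorem comp (ha : IsSigned a) (σ : Equiv.Perm (Fin n)) : IsSigned (a ∘ σ) where
  one_le i := ha.one_le (σ i)
  le i := ha.le (σ i)
  abs_injective := ha.abs_injective.comp σ.injective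

theorem of_abs_eq (ha : IsSigned a) {b : Fin n → ℤ} (h : ∀ i, |b i| = |a i|) : IsSigned b where
  one_le i := h i ▸ ha.one_le i
  le i := h i ▸ ha.le i
  abs_injective i j hij := ha.abs_injective (by simpa only [h] using hij)

theorem neg (ha : IsSigned a) : IsSigned (-a) := ha.of_abs_eq fun i => by simp

theorem two_mul_sum_abs (ha : IsSigned a) : 2 * ∑ i, |a i| = (n : ℤ) * (n + 1) := by
  have hid : IsSigned fun i : Fin n => ((i : ℕ) : ℤ) + 1 :=
    ⟨fun _ => by rw [abs_of_nonneg (by positivity)]; omega,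
      fun _ => by rw [abs_of_nonneg (by positivity)]; omega,
      fun i j h => by
        simp only [abs_of_nonneg (show (0 : ℤ) ≤ ((i : ℕ) : ℤ) + 1 by positivity),
          abs_of_nonneg (show (0 : ℤ) ≤ ((j : ℕ) : ℤ) + 1 by positivity)] at h
        exact Fin.ext (by omega)⟩
  have key : ∀ {b : Fin n → ℤ}, IsSigned b → ∑ i, |b i| = ∑ x ∈ Finset.Icc (1 : ℤ) n, x := by
    intro b hb
    rw [← hb.image_abs, Finset.sum_image hb.abs_injective.injOn]
  rw [key ha, ← key hid, ← two_mul_sum_fin_succ]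
  exact congrArg (2 * ·) (Finset.sum_congr rfl fun i _ => abs_of_nonneg (by positivity))

theorem card_abs_lt (ha : IsSigned a) {m : ℤ} (h1 : 1 ≤ m) (hm : m ≤ n) :
    ((Finset.univ.filter fun i => |a i| < m).card : ℤ) = m - 1 := by
  have : (Finset.univ.filter fun i => |a i| < m).image (fun i => |a i|) =
      Finset.Icc (1 : ℤ) (m - 1) := by
    ext x
    have hx : x ∈ Finset.univ.image (fun i => |a i|) ↔ x ∈ Finset.Icc (1 : ℤ) n := by
      rw [ha.image_abs]
    simp only [Finset.mem_image, Finset.mem_univ, true_and, Finset.mem_Icc,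
      Finset.mem_filter] at hx ⊢
    constructor
    · rintro ⟨i, hi, rfl⟩
      exact ⟨ha.one_le i, by omega⟩
    · rintro ⟨h2, h3⟩
      obtain ⟨i, hi⟩ := hx.2 ⟨h2, by omega⟩
      exact ⟨i, by omega, hi⟩
  rw [← Finset.card_image_of_injective _ ha.abs_injective, this, Int.card_Icc]
  omega

end IsSigned

theorem negSum_eq_sum_min {n : ℕ} (a : Fin n → ℤ) : negSum a = ∑ i, min (a i) 0 := by
  rw [negSum, Finset.sum_filter]
  refine Finset.sum_congr rfl fun i _ => ?_
  split_ifs with h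
  · exact (min_eq_left h.le).symm
  · exact (min_eq_right (not_lt.1 h)).symm

theorem negSum_nonpos {n : ℕ} (a : Fin n → ℤ) : negSum a ≤ 0 := by
  rw [negSum_eq_sum_min]
  exact Finset.sum_nonpos fun i _ => min_le_right _ _

theorem negSum_comp {n : ℕ} (a : Fin n → ℤ) (σ : Equiv.Perm (Fin n)) :
    negSum (a ∘ σ) = negSum a := by
  rw [negSum_eq_sum_min, negSum_eq_sum_min]
  exact Equiv.sum_comp σ fun i => min (a i) 0

theorem negSum_add_neg {n : ℕ} (a : Fin n → ℤ) : negSum a + negSum (-a) = -∑ i, |a i| := by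
  rw [negSum_eq_sum_min, negSum_eq_sum_min, ← Finset.sum_add_distrib, ← Finset.sum_neg_distrib]
  refine Finset.sum_congr rfl fun i _ => ?_
  rw [Pi.neg_apply]
  rcases le_total (a i) 0 with h | h
  · rw [abs_of_nonpos h]; omega
  · rw [abs_of_nonneg h]; omega

/-- The Coxeter length of a signed permutation in terms of its sequence. -/
def signedLength {n : ℕ} (a : Fin n → ℤ) : ℤ := invCount a - negSum a

theorem signedLength_nonneg {n : ℕ} (a : Fin n → ℤ) : 0 ≤ signedLength a := by
  have := negSum_nonpos a
  unfold signedLength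
  omega

theorem invCount_eq_first_row_add {n : ℕ} (a : Fin n → ℤ) (z : Fin n) (hz : (z : ℕ) = 0) :
    invCount a = (Finset.univ.filter fun j => j ≠ z ∧ a j < a z).card +
      (Finset.univ.filter fun p : Fin n × Fin n =>
        p.1 ≠ z ∧ p.1 < p.2 ∧ a p.2 < a p.1).card := by
  rw [invCount, ← Finset.card_filter_add_card_filter_not (fun p : Fin n × Fin n => p.1 = z),
    Finset.filter_filter, Finset.filter_filter]
  congr 1
  · refine Finset.card_bij' (fun p _ => p.2) (fun j _ => (z, j)) ?_ ?_ ?_ ?_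
    · rintro ⟨i, j⟩ h
      simp only [Finset.mem_filter, Finset.mem_univ, true_and] at h ⊢
      obtain ⟨⟨h1, h2⟩, rfl⟩ := h
      exact ⟨h1.ne', h2⟩
    · intro j h
      simp only [Finset.mem_filter, Finset.mem_univ, true_and] at h ⊢
      refine ⟨⟨?_, h.2⟩, trivial⟩
      have := h.1
      rw [Ne, Fin.ext_iff] at this
      rw [Fin.lt_def]
      omega
    · rintro ⟨i, j⟩ h
      simp only [Finset.mem_filter, Finset.mem_univ, true_and] at h
      simp [h.2]
    · intro j h
      rfl
  · congr 1
    ext p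
    simp only [Finset.mem_filter, Finset.mem_univ, true_and]
    tauto

/-- With m = `a z`, the sign change destroys the inversions `(z, j)` with `|a j| < m`, which number
m - 1, and touches no other pair. The negative sum falls by m, so the net change is +1. -/
theorem signedLength_update_neg {n : ℕ} {a : Fin n → ℤ} (ha : IsSigned a) {z : Fin n}
    (hz : (z : ℕ) = 0) (hpos : 0 < a z) :
    signedLength (Function.update a z (-a z)) = signedLength a + 1 := by
  set b := Function.update a z (-a z) with hb
  have hbz : b z = -a z := Function.update_self ..
  have hbj : ∀ j, j ≠ z → b j = a j := fun j hj => Function.update_of_ne hj ..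
  have hrest : (Finset.univ.filter fun p : Fin n × Fin n =>
      p.1 ≠ z ∧ p.1 < p.2 ∧ b p.2 < b p.1) = Finset.univ.filter fun p : Fin n × Fin n =>
      p.1 ≠ z ∧ p.1 < p.2 ∧ a p.2 < a p.1 := by
    ext ⟨i, j⟩
    simp only [Finset.mem_filter, Finset.mem_univ, true_and]
    refine and_congr_right fun hi => and_congr_right fun hij => ?_
    have hj : j ≠ z := by
      rintro rfl
      rw [Fin.lt_def] at hij
      omega
    rw [hbj i hi, hbj j hj]
  -- The terms below `a z` are those below `-a z` and those of absolute value below `a z`; the value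
  -- `-a z` itself is excluded because absolute values are distinct.
  have hrow : (Finset.univ.filter fun j => j ≠ z ∧ a j < a z).card =
      (Finset.univ.filter fun j => j ≠ z ∧ b j < b z).card +
        (Finset.univ.filter fun j => |a j| < a z).card := by
    rw [← Finset.card_filter_add_card_filter_not (s := Finset.univ.filter
      fun j => j ≠ z ∧ a j < a z) (fun j => a j < -a z), Finset.filter_filter,
      Finset.filter_filter]
    congr 2
    · ext j
      simp only [Finset.mem_filter, Finset.mem_univ, true_and]
      constructor
      · rintro ⟨⟨h1, -⟩, h2⟩
        exact ⟨h1, by rwa [hbj j h1, hbz]⟩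
      · rintro ⟨h1, h2⟩
        rw [hbj j h1, hbz] at h2
        exact ⟨⟨h1, by omega⟩, h2⟩
    · ext j
      simp only [Finset.mem_filter, Finset.mem_univ, true_and, not_lt]
      constructor
      · rintro ⟨⟨h1, h2⟩, h3⟩
        have hne : a j ≠ -a z := fun h => h1 (ha.abs_injective (by simp [h]))
        rw [abs_lt]
        omega
      · intro h
        have h1 : j ≠ z := by
          rintro rfl
          exact absurd h (not_lt.2 (le_abs_self _))
        rw [abs_lt] at h
        exact ⟨⟨h1, h.2⟩, h.1.le⟩
  have hneg : negSum b = negSum a - a z := by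
    rw [negSum_eq_sum_min, negSum_eq_sum_min, ← Finset.add_sum_erase _ _ (Finset.mem_univ z),
      ← Finset.add_sum_erase _ (fun i => min (a i) 0) (Finset.mem_univ z), hbz,
      Finset.sum_congr rfl fun j hj => by rw [hbj j (Finset.ne_of_mem_erase hj)],
      min_eq_left (by omega), min_eq_right hpos.le]
    ring
  have hc := ha.card_abs_lt (m := a z) (by omega) ((le_abs_self _).trans (ha.le z))
  have e1 := invCount_eq_first_row_add a z hz
  have e2 := invCount_eq_first_row_add b z hz
  rw [hrest] at e2
  unfold signedLength
  omega

theorem signedLength_update_neg_of_neg {n : ℕ} {a : Fin n → ℤ} (ha : IsSigned a) {z : Fin n}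
    (hz : (z : ℕ) = 0) (hneg : a z < 0) :
    signedLength (Function.update a z (-a z)) + 1 = signedLength a := by
  have hs : IsSigned (Function.update a z (-a z)) := by
    refine ha.of_abs_eq fun i => ?_
    by_cases h : i = z
    · subst h; simp
    · rw [Function.update_of_ne h]
  have := signedLength_update_neg hs hz (by simpa using hneg)
  rw [← this]
  simp

/-! ### The length functions -/

theorem isSigned_seqA {n : ℕ} (σ : Equiv.Perm (Fin n)) : IsSigned (seqA σ) where
  one_le i := by rw [seqA, abs_of_nonneg (by positivity)]; omega
  le i := by rw [seqA, abs_of_nonneg (by positivity)]; omega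
  abs_injective i j h := by
    simp only [seqA] at h
    rw [abs_of_nonneg (by positivity), abs_of_nonneg (by positivity)] at h
    exact σ.injective (Fin.ext (by omega))

theorem adjacent_lt_or_exists_gt {n : ℕ} {a : Fin n → ℤ} (ha : Function.Injective a) :
    (∀ i j : Fin n, (j : ℕ) = i + 1 → a i < a j) ∨
      ∃ i j : Fin n, (j : ℕ) = i + 1 ∧ a j < a i := by
  by_contra! h
  obtain ⟨⟨i, j, hij, h1⟩, h2⟩ := h
  have := ha (le_antisymm (h2 i j hij) h1)
  rw [Fin.ext_iff] at this
  omega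

theorem lenA_eq {n : ℕ} (σ : Equiv.Perm (Fin n)) : lenA n σ = invCount (seqA σ) := by
  refine wordLength_eq_of_descent (simpleA n) (fun σ => (invCount (seqA σ) : ℤ)) ?_ ?_ ?_ ?_ ?_ σ
  · rintro s ⟨i, j, -, rfl⟩
    exact Equiv.swap_mul_self i j
  · simp only [Nat.cast_eq_zero]
    refine invCount_eq_zero fun i j hij => ?_
    simpa [seqA] using hij
  · intro w
    positivity
  · rintro w s ⟨i, j, hij, rfl⟩
    have he : seqA (w * Equiv.swap i j) = seqA w ∘ Equiv.swap i j := rfl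
    have hne : seqA w i ≠ seqA w j := fun h => by
      have := (isSigned_seqA w).injective h
      rw [Fin.ext_iff] at this
      omega
    simp only [he]
    rcases lt_or_gt_of_ne hne with h | h
    · rw [invCount_comp_swap _ hij h]
      simp
    · rw [← invCount_comp_swap_of_gt _ hij h]
      push_cast
      linarith
  · intro w hw
    rcases adjacent_lt_or_exists_gt (isSigned_seqA w).injective with h | ⟨i, j, hij, h⟩
    · refine absurd (Equiv.ext fun i => Fin.ext ?_) hw
      have := eq_succ_of_adjacent_lt h (fun i => by simp [seqA]) (fun i => by simp only [seqA]; omega) i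
      simp only [seqA] at this
      simp only [Equiv.Perm.coe_one, id]
      omega
    · refine ⟨Equiv.swap i j, ⟨i, j, hij, rfl⟩, ?_⟩
      have he : seqA (w * Equiv.swap i j) = seqA w ∘ Equiv.swap i j := rfl
      simp only [he]
      rw [← invCount_comp_swap_of_gt _ hij h]
      push_cast
      rfl

theorem exists_pos_or_neg {n : ℕ} (x : PM n) : ∃ k : Fin n, x = pos k ∨ x = -pos k := by
  obtain ⟨x, h0, hx⟩ := x
  rw [abs_le] at hx
  refine ⟨⟨x.natAbs - 1, by omega⟩, ?_⟩
  rcases lt_or_gt_of_ne h0 with h | h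
  · right
    apply Subtype.ext
    change x = -(((x.natAbs - 1 : ℕ) : ℤ) + 1)
    omega
  · left
    apply Subtype.ext
    change x = ((x.natAbs - 1 : ℕ) : ℤ) + 1
    omega

theorem pos_injective {n : ℕ} : Function.Injective (pos : Fin n → PM n) := by
  intro i j h
  have : ((i : ℕ) : ℤ) + 1 = (j : ℕ) + 1 := congrArg Subtype.val h
  exact Fin.ext (by omega)

theorem pos_ne_neg_pos {n : ℕ} (i j : Fin n) : pos i ≠ -pos j := by
  intro h
  have : ((i : ℕ) : ℤ) + 1 = -((j : ℕ) + 1) := congrArg Subtype.val h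
  omega

theorem coe_neg_PM {n : ℕ} (x : PM n) : (-x).1 = -x.1 := rfl

theorem isSigned_seqB {n : ℕ} (w : SB n) : IsSigned (seqB w) where
  one_le i := Int.one_le_abs (w.1 (pos i)).2.1
  le i := (w.1 (pos i)).2.2
  abs_injective i j h := by
    rcases abs_eq_abs.1 h with h | h
    · exact pos_injective (w.1.injective (Subtype.ext h))
    · have h2 : w.1 (pos i) = w.1 (-pos j) := by
        rw [w.2]
        exact Subtype.ext h
      exact absurd (w.1.injective h2) (pos_ne_neg_pos i j)

theorem seqB_mul_zero {n : ℕ} (w s : SB n) (i : Fin n)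
    (hs : s.1 = Equiv.swap (pos i) (-pos i)) :
    seqB (w * s) = Function.update (seqB w) i (-seqB w i) := by
  ext k
  have he : seqB (w * s) k = (w.1 (s.1 (pos k))).1 := rfl
  rw [he, hs]
  by_cases h : k = i
  · subst h
    rw [Equiv.swap_apply_left, Function.update_self, w.2]
    rfl
  · rw [Equiv.swap_apply_of_ne_of_ne (pos_injective.ne h) (pos_ne_neg_pos k i),
      Function.update_of_ne h]
    rfl

theorem seqB_mul_adjacent {n : ℕ} (w s : SB n) (i j : Fin n)
    (hs : s.1 = Equiv.swap (pos i) (pos j) * Equiv.swap (-pos i) (-pos j)) :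
    seqB (w * s) = seqB w ∘ Equiv.swap i j := by
  ext k
  have he : seqB (w * s) k = (w.1 (s.1 (pos k))).1 := rfl
  rw [he, hs, Equiv.Perm.mul_apply,
    Equiv.swap_apply_of_ne_of_ne (pos_ne_neg_pos k i) (pos_ne_neg_pos k j),
    pos_injective.swap_apply]
  rfl

theorem eq_one_of_seqB {n : ℕ} {w : SB n} (h : ∀ i, seqB w i = (i : ℕ) + 1) : w = 1 := by
  apply Subtype.ext
  refine Equiv.ext fun x => ?_
  have hp : ∀ k, w.1 (pos k) = pos k := fun k => Subtype.ext (h k)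
  change w.1 x = x
  obtain ⟨k, rfl | rfl⟩ := exists_pos_or_neg x
  · exact hp k
  · rw [w.2, hp]

/-- Every signed sequence is the sequence of an element of `SB n`. -/
theorem exists_seqB_eq {n : ℕ} {b : Fin n → ℤ} (hb : IsSigned b) : ∃ w : SB n, seqB w = b := by
  have hidx : ∀ x : PM n, x.1.natAbs - 1 < n := fun x => by
    have h1 := x.2.1
    have h2 := abs_le.1 x.2.2
    omega
  let idx : PM n → Fin n := fun x => ⟨x.1.natAbs - 1, hidx x⟩
  -- The odd extension of `b`: the sign of x times the term of `b` indexed by |x|.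
  let f : PM n → PM n := fun x => ⟨x.1.sign * b (idx x),
    mul_ne_zero (by simpa using x.2.1) (hb.ne_zero _), by
      rw [abs_mul, Int.abs_sign_of_ne_zero x.2.1, one_mul]
      exact hb.le _⟩
  have hneg : ∀ x, f (-x) = -f x := by
    intro x
    apply Subtype.ext
    have h1 : idx (-x) = idx x := Fin.ext (by simp [idx, coe_neg_PM])
    change (-x).1.sign * b (idx (-x)) = -(x.1.sign * b (idx x))
    rw [h1, coe_neg_PM, Int.sign_neg, neg_mul]
  have hpos : ∀ k, (f (pos k)).1 = b k := by
    intro k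
    have h1 : idx (pos k) = k := Fin.ext (by simp only [idx, pos]; omega)
    have h2 : (pos k).1.sign = 1 := Int.sign_eq_one_of_pos (by simp only [pos]; omega)
    change (pos k).1.sign * b (idx (pos k)) = b k
    rw [h1, h2, one_mul]
  have hinj : Function.Injective f := by
    have habs : ∀ k l : Fin n, |(f (pos k)).1| = |(f (pos l)).1| → k = l := fun k l h =>
      hb.abs_injective (by simpa only [hpos] using h)
    have hsgn : ∀ k : Fin n, f (pos k) ≠ f (-pos k) := by
      intro k h
      have h1 := congrArg Subtype.val h
      rw [hneg, coe_neg_PM, hpos] at h1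
      have := hb.ne_zero k
      omega
    intro x y h
    have h2 := congrArg (fun x : PM n => |x.1|) h
    have hn : ∀ k : Fin n, |(f (-pos k)).1| = |(f (pos k)).1| := fun k => by
      rw [hneg, coe_neg_PM, abs_neg]
    obtain ⟨k, rfl | rfl⟩ := exists_pos_or_neg x
    · obtain ⟨l, rfl | rfl⟩ := exists_pos_or_neg y
      · rw [habs k l h2]
      · obtain rfl := habs k l (h2.trans (hn l))
        exact absurd h (hsgn k)
    · obtain ⟨l, rfl | rfl⟩ := exists_pos_or_neg y
      · obtain rfl := habs k l ((hn k).symm.trans h2)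
        exact absurd h.symm (hsgn k)
      · rw [habs k l ((hn k).symm.trans (h2.trans (hn l)))]
  have : Finite (PM n) :=
    ((Set.finite_Icc (-(n : ℤ)) n).subset fun a (ha : a ≠ 0 ∧ |a| ≤ (n : ℤ)) =>
      abs_le.1 ha.2).to_subtype
  exact ⟨⟨Equiv.ofBijective f (Finite.injective_iff_bijective.1 hinj), hneg⟩, funext hpos⟩

/-- Right multiplication by s₀ changes the sign of the first term; by another generator it exchanges
adjacent terms and keeps the negative sum. Without a descent the sequence increases from a positive
first term, which forces the identity. -/
theorem lenB_eq {n : ℕ} (w : SB n) : lenB n w = signedLength (seqB w) := by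
  have hzero : ∀ s : SB n, ∀ i : Fin n, s.1 = Equiv.swap (pos i) (-pos i) → s * s = 1 := by
    intro s i hs
    apply Subtype.ext
    change s.1 * s.1 = 1
    rw [hs, Equiv.swap_mul_self]
  -- The two factors of a generator have disjoint supports; commutation makes the generator an
  -- involution and compatible with negation.
  have hdisj : ∀ i j : Fin n, Commute (Equiv.swap (pos i) (pos j))
      (Equiv.swap (-pos i) (-pos j)) := by
    intro i j
    refine Equiv.Perm.Disjoint.commute fun x => ?_
    obtain ⟨k, rfl | rfl⟩ := exists_pos_or_neg x
    · exact Or.inr (Equiv.swap_apply_of_ne_of_ne (pos_ne_neg_pos k i) (pos_ne_neg_pos k j))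
    · exact Or.inl (Equiv.swap_apply_of_ne_of_ne (pos_ne_neg_pos i k).symm
        (pos_ne_neg_pos j k).symm)
  refine wordLength_eq_of_descent (simpleB n) (fun w => signedLength (seqB w)) ?_ ?_ ?_ ?_ ?_ w
  · rintro s (⟨i, -, hs⟩ | ⟨i, j, -, hs⟩)
    · exact hzero s i hs
    · apply Subtype.ext
      change s.1 * s.1 = 1
      rw [hs, (hdisj i j).symm.mul_mul_mul_comm, Equiv.swap_mul_self, Equiv.swap_mul_self, one_mul]
  · have h1 : ∀ i, seqB (1 : SB n) i = (i : ℕ) + 1 := fun i => rfl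
    have h2 : invCount (seqB (1 : SB n)) = 0 := invCount_eq_zero fun i j hij => by
      rw [h1, h1]
      rw [Fin.lt_def] at hij
      omega
    have h3 : negSum (seqB (1 : SB n)) = 0 := by
      rw [negSum_eq_sum_min]
      refine Finset.sum_eq_zero fun i _ => ?_
      rw [h1]
      omega
    simp [signedLength, h2, h3]
  · exact fun w => signedLength_nonneg _
  · rintro w s (⟨i, hi, hs⟩ | ⟨i, j, hij, hs⟩)
    · simp only [seqB_mul_zero w s i hs]
      rcases lt_or_gt_of_ne ((isSigned_seqB w).ne_zero i) with h | h
      · have := signedLength_update_neg_of_neg (isSigned_seqB w) hi h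
        omega
      · exact (signedLength_update_neg (isSigned_seqB w) hi h).le
    · simp only [seqB_mul_adjacent w s i j hs, signedLength, negSum_comp]
      have hne : seqB w i ≠ seqB w j := fun h => by
        have := (isSigned_seqB w).injective h
        rw [Fin.ext_iff] at this
        omega
      rcases lt_or_gt_of_ne hne with h | h
      · have := invCount_comp_swap _ hij h
        omega
      · have := invCount_comp_swap_of_gt _ hij h
        omega
  · intro w hw
    have hmem : ∀ i : Fin n, Equiv.swap (pos i) (-pos i) ∈ SB n := by
      intro i x
      obtain ⟨k, rfl | rfl⟩ := exists_pos_or_neg x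
      all_goals
        by_cases h : k = i
        · subst h
          simp
        · have e1 : Equiv.swap (pos i) (-pos i) (pos k) = pos k :=
            Equiv.swap_apply_of_ne_of_ne (pos_injective.ne h) (pos_ne_neg_pos k i)
          have e2 : Equiv.swap (pos i) (-pos i) (-pos k) = -pos k :=
            Equiv.swap_apply_of_ne_of_ne (pos_ne_neg_pos i k).symm
              (fun hc => h (pos_injective (neg_injective hc)))
          simp only [neg_neg, e1, e2]
    have hmem2 : ∀ i j : Fin n,
        Equiv.swap (pos i) (pos j) * Equiv.swap (-pos i) (-pos j) ∈ SB n := by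
      intro i j x
      have hn : ∀ y : PM n, Equiv.swap (-pos i) (-pos j) (-y) =
          -Equiv.swap (pos i) (pos j) y := fun y => (neg_injective.swap_apply ..)
      have hn2 : ∀ y : PM n, Equiv.swap (pos i) (pos j) (-y) =
          -Equiv.swap (-pos i) (-pos j) y := fun y => by
        rw [← neg_neg (Equiv.swap (pos i) (pos j) (-y)), ← hn, neg_neg]
      rw [Equiv.Perm.mul_apply, hn, hn2, ← Equiv.Perm.mul_apply, ← (hdisj i j).eq]
    rcases adjacent_lt_or_exists_gt (isSigned_seqB w).injective with h | ⟨i, j, hij, h⟩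
    · by_cases hz : ∃ z : Fin n, (z : ℕ) = 0 ∧ seqB w z < 0
      · obtain ⟨z, hz, hlt⟩ := hz
        refine ⟨⟨_, hmem z⟩, Or.inl ⟨z, hz, rfl⟩, ?_⟩
        simp only [seqB_mul_zero w ⟨_, hmem z⟩ z rfl]
        exact signedLength_update_neg_of_neg (isSigned_seqB w) hz hlt
      · push Not at hz
        refine absurd (eq_one_of_seqB (eq_succ_of_adjacent_lt h (fun i => ?_) fun i =>
          (le_abs_self _).trans ((isSigned_seqB w).le i))) hw
        have h1 := hz ⟨0, i.pos⟩ rfl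
        have h2 := (isSigned_seqB w).ne_zero ⟨0, i.pos⟩
        have h3 := add_le_of_adjacent_lt h (i := ⟨0, i.pos⟩) (j := i) (by simp [Fin.le_def])
        simp only at h3
        omega
    · refine ⟨⟨_, hmem2 i j⟩, Or.inr ⟨i, j, hij, rfl⟩, ?_⟩
      simp only [seqB_mul_adjacent w ⟨_, hmem2 i j⟩ i j rfl, signedLength, negSum_comp]
      have := invCount_comp_swap_of_gt _ hij h
      omega

/-! ### The images -/

theorem strictMono_comp_sort {n : ℕ} {a : Fin n → ℤ} (ha : Function.Injective a) :
    StrictMono (a ∘ Tuple.sort a) :=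
  (Tuple.monotone_sort a).strictMono_of_injective (ha.comp (Tuple.sort a).injective)

/-- The inverse of the sorting permutation sends each position to the rank of its term. -/
theorem exists_perm_same_order {n : ℕ} {a : Fin n → ℤ} (ha : Function.Injective a) :
    ∃ σ : Equiv.Perm (Fin n), ∀ i j, seqA σ i < seqA σ j ↔ a i < a j := by
  refine ⟨(Tuple.sort a)⁻¹, fun i j => ?_⟩
  have := (strictMono_comp_sort ha).lt_iff_lt (a := (Tuple.sort a)⁻¹ i) (b := (Tuple.sort a)⁻¹ j)
  simp only [Function.comp_apply, Equiv.Perm.inv_def, Equiv.apply_symm_apply] at this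
  rw [this, Fin.lt_def]
  simp [seqA]

theorem range_lenB_sub_nmaj (n : ℕ) :
    Set.range (lenB n - nmaj n) = Set.range (lenA n - majA n) := by
  have hB : ∀ w, (lenB n - nmaj n) w = invCount (seqB w) - maj (seqB w) := fun w => by
    rw [Pi.sub_apply, lenB_eq, signedLength, nmaj]
    ring
  have hA : ∀ σ, (lenA n - majA n) σ = invCount (seqA σ) - maj (seqA σ) := fun σ => by
    rw [Pi.sub_apply, lenA_eq, majA]
  ext v
  constructor
  · rintro ⟨w, rfl⟩
    obtain ⟨σ, hσ⟩ := exists_perm_same_order (isSigned_seqB w).injective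
    exact ⟨σ, by rw [hA, hB, invCount_congr hσ, maj_congr hσ]⟩
  · rintro ⟨σ, rfl⟩
    obtain ⟨w, hw⟩ := exists_seqB_eq (isSigned_seqA σ)
    exact ⟨w, by rw [hA, hB, hw]⟩

/-- The sum of the statistics `ℓ_B` and `nmaj` in terms of the sequence. -/
noncomputable def sumStat {n : ℕ} (a : Fin n → ℤ) : ℤ := invCount a + maj a - 2 * negSum a

theorem mem_range_lenB_add_nmaj {n : ℕ} {v : ℤ} :
    v ∈ Set.range (lenB n + nmaj n) ↔ ∃ a : Fin n → ℤ, IsSigned a ∧ sumStat a = v := by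
  have hB : ∀ w, (lenB n + nmaj n) w = sumStat (seqB w) := fun w => by
    rw [Pi.add_apply, lenB_eq, signedLength, nmaj, sumStat]
    ring
  constructor
  · rintro ⟨w, rfl⟩
    exact ⟨seqB w, isSigned_seqB w, (hB w).symm⟩
  · rintro ⟨a, ha, rfl⟩
    obtain ⟨w, rfl⟩ := exists_seqB_eq ha
    exact ⟨w, hB w⟩

/-! ### Negation symmetry and excluded values -/

theorem invCount_add_maj_neg {n : ℕ} {a : Fin n → ℤ} (ha : Function.Injective a) :
    (invCount (-a) : ℤ) + maj (-a) = n * (n - 1) - (invCount a + maj a) := by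
  have h1 := two_mul_invCount_add_neg ha
  have h2 := two_mul_maj_add_neg ha
  linarith

theorem two_mul_negSum_neg {n : ℕ} {a : Fin n → ℤ} (ha : IsSigned a) :
    2 * negSum (-a) = -(n * (n + 1)) - 2 * negSum a := by
  have h1 := negSum_add_neg a
  have h2 := ha.two_mul_sum_abs
  linarith

theorem sumStat_neg {n : ℕ} {a : Fin n → ℤ} (ha : IsSigned a) :
    sumStat (-a) = 2 * n ^ 2 - sumStat a := by
  have h1 := invCount_add_maj_neg ha.injective
  have h2 := two_mul_negSum_neg ha
  unfold sumStat
  linarith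

theorem sumStat_nonneg {n : ℕ} (a : Fin n → ℤ) : 0 ≤ sumStat a := by
  have h1 := negSum_nonpos a
  have h2 := maj_nonneg a
  unfold sumStat
  omega

/-- The term `-2 * negSum a` is even and nonnegative, so the value 1 would force inversions plus
major index to be 1. -/
theorem sumStat_ne_one {n : ℕ} {a : Fin n → ℤ} (ha : IsSigned a) : sumStat a ≠ 1 := by
  have h1 := negSum_nonpos a
  have h2 := maj_nonneg a
  have h3 := invCount_add_maj_ne_one ha.injective
  unfold sumStat
  omega

/-- For n = 2 inversions plus major index lies in [0, 2], by complementation under negation, and is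
not 1. -/
theorem even_sumStat_two {a : Fin 2 → ℤ} (ha : IsSigned a) : Even (sumStat a) := by
  have h1 := invCount_add_maj_ne_one ha.injective
  have h2 := maj_nonneg a
  have h3 := maj_nonneg (-a)
  have h4 := invCount_add_maj_neg ha.injective
  push_cast at h4
  rw [Int.even_iff]
  unfold sumStat
  omega

/-! ### Realizing the remaining values -/

theorem exists_subset_sum_succ (n : ℕ) {N : ℤ} (h0 : 0 ≤ N) (hN : 2 * N ≤ n * (n + 1)) :
    ∃ J ⊆ Finset.range n, ∑ j ∈ J, ((j : ℤ) + 1) = N := by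
  induction n generalizing N with
  | zero => exact ⟨∅, by simp, by push_cast at hN; simp; omega⟩
  | succ n ih =>
    by_cases h : 2 * N ≤ n * (n + 1)
    · obtain ⟨J, hJ, hs⟩ := ih h0 h
      exact ⟨J, hJ.trans (Finset.range_mono (by omega)), hs⟩
    · push_cast at hN
      -- Greedy choice: if 1, …, n cannot reach N, the part n + 1 is used and fits into N.
      have h1 : (n : ℤ) + 1 ≤ N := by
        by_contra hc
        have : N ≤ n := by omega
        rcases Nat.eq_zero_or_pos n with rfl | hn
        · push_cast at *
          omega
        · have : (1 : ℤ) ≤ n := by exact_mod_cast hn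
          nlinarith
      obtain ⟨J, hJ, hs⟩ := ih (N := N - (n + 1)) (by omega) (by nlinarith)
      have hn : n ∉ J := fun h => by simpa using hJ h
      refine ⟨insert n J, ?_, by rw [Finset.sum_insert hn, hs]; ring⟩
      rw [Finset.range_add_one]
      exact Finset.insert_subset_insert _ hJ

/-- A subset with sum N tells which absolute values receive a minus sign; sorting then preserves the
negative sum. -/
theorem exists_strictMono_isSigned (n : ℕ) {N : ℤ} (h0 : 0 ≤ N) (hN : 2 * N ≤ n * (n + 1)) :
    ∃ c : Fin n → ℤ, IsSigned c ∧ StrictMono c ∧ negSum c = -N := by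
  obtain ⟨J, hJ, hs⟩ := exists_subset_sum_succ n h0 hN
  let d : Fin n → ℤ := fun i => if (i : ℕ) ∈ J then -(((i : ℕ) : ℤ) + 1) else ((i : ℕ) : ℤ) + 1
  have hd : IsSigned d := by
    refine (isSigned_seqA 1).of_abs_eq fun i => ?_
    simp only [d, seqA]
    split_ifs
    · rw [abs_neg]
      rfl
    · rfl
  refine ⟨d ∘ Tuple.sort d, hd.comp _, strictMono_comp_sort hd.injective, ?_⟩
  rw [negSum_comp, negSum_eq_sum_min, ← hs, ← Finset.inter_eq_right.2 hJ, ← Finset.sum_ite_mem,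
    ← Finset.sum_neg_distrib, Finset.sum_range]
  refine Finset.sum_congr rfl fun i _ => ?_
  simp only [d]
  split_ifs <;> omega

theorem exists_sumStat_eq_even (n : ℕ) {N : ℤ} (h0 : 0 ≤ N) (hN : 2 * N ≤ n * (n + 1)) :
    ∃ a : Fin n → ℤ, IsSigned a ∧ sumStat a = 2 * N := by
  obtain ⟨c, hc, hm, hs⟩ := exists_strictMono_isSigned n h0 hN
  refine ⟨c, hc, ?_⟩
  have h1 := invCount_eq_zero hm
  have h2 := maj_eq_zero_of_invCount_eq_zero h1
  rw [sumStat, h1, h2, hs]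
  push_cast
  ring

theorem maj_comp_swap_one_two {n : ℕ} {c : Fin n → ℤ} (hc : StrictMono c) {i j : Fin n}
    (hij : (j : ℕ) = i + 1) : maj (c ∘ Equiv.swap i j) = (i : ℕ) + 1 := by
  classical
  have key : ∀ k, IsDescent (c ∘ Equiv.swap i j) k ↔ k = i := by
    intro k
    constructor
    · rintro ⟨l, hl, hkl, h⟩
      by_contra hne
      have := swap_lt_swap_of_adjacent hij hkl fun h => hne h.1
      exact absurd h (not_lt.2 (hc this).le)
    · rintro rfl
      have hlt : k < j := by rw [Fin.lt_def]; omega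
      exact ⟨j, hij, hlt, by simpa using hc hlt⟩
  simp only [maj, key]
  rw [Finset.sum_filter, Finset.sum_ite_eq' Finset.univ i]
  simp

theorem exists_sumStat_eq_odd {n : ℕ} (hn : 2 < n) {N : ℤ} (h0 : 0 ≤ N)
    (hN : 2 * N ≤ n * (n + 1)) : ∃ a : Fin n → ℤ, IsSigned a ∧ sumStat a = 2 * N + 3 := by
  obtain ⟨c, hc, hm, hs⟩ := exists_strictMono_isSigned n h0 hN
  -- Exchanging the second and third terms creates one inversion and a single descent at 2, hence
  -- the added 3; this needs n > 2.
  let i : Fin n := ⟨1, by omega⟩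
  let j : Fin n := ⟨2, hn⟩
  have hij : (j : ℕ) = i + 1 := rfl
  refine ⟨c ∘ Equiv.swap i j, hc.comp _, ?_⟩
  have hlt : i < j := by rw [Fin.lt_def]; omega
  rw [sumStat, invCount_comp_swap c hij (hm hlt), invCount_eq_zero hm,
    maj_comp_swap_one_two hm hij, negSum_comp, hs]
  simp only [i]
  push_cast
  ring

theorem exists_sumStat_eq_of_even (n : ℕ) {v : ℤ} (hv : Even v) (h0 : 0 ≤ v)
    (h2 : v ≤ 2 * n ^ 2) : ∃ a : Fin n → ℤ, IsSigned a ∧ sumStat a = v := by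
  obtain ⟨N, rfl⟩ := hv
  by_cases h : N + N ≤ n * (n + 1)
  · obtain ⟨a, ha, hs⟩ := exists_sumStat_eq_even n (N := N) (by omega) (by linarith)
    exact ⟨a, ha, by rw [hs]; ring⟩
  -- Above n(n + 1), the reflected value 2n² - 2N lies below n(n - 1), so it is already realized.
  · obtain ⟨a, ha, hs⟩ := exists_sumStat_eq_even n (N := n ^ 2 - N) (by linarith) (by nlinarith)
    exact ⟨-a, ha.neg, by rw [sumStat_neg ha, hs]; ring⟩

theorem exists_sumStat_eq_of_odd {n : ℕ} (hn : 2 < n) {v : ℤ} (hv : Odd v) (h0 : 3 ≤ v)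
    (h2 : v ≤ 2 * n ^ 2 - 3) : ∃ a : Fin n → ℤ, IsSigned a ∧ sumStat a = v := by
  obtain ⟨N, rfl⟩ := hv
  by_cases h : 2 * (N - 1) ≤ n * (n + 1)
  · obtain ⟨a, ha, hs⟩ := exists_sumStat_eq_odd hn (N := N - 1) (by omega) h
    exact ⟨a, ha, by rw [hs]; ring⟩
  -- The witness comes from 2n² - (2N + 1) = 2(n² - N - 2) + 3.
  · obtain ⟨a, ha, hs⟩ := exists_sumStat_eq_odd hn (N := n ^ 2 - N - 2) (by omega) (by nlinarith)
    exact ⟨-a, ha.neg, by rw [sumStat_neg ha, hs]; ring⟩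

/-! ### The image of the sum and its size -/

theorem range_lenB_add_nmaj_two :
    Set.range (lenB 2 + nmaj 2) = ({0, 2, 4, 6, 8} : Finset ℤ) := by
  ext v
  rw [mem_range_lenB_add_nmaj]
  simp only [Finset.coe_insert, Finset.coe_singleton, Set.mem_insert_iff, Set.mem_singleton_iff]
  constructor
  · rintro ⟨a, ha, rfl⟩
    have h1 := sumStat_nonneg a
    have h2 := sumStat_nonneg (-a)
    have h3 := even_sumStat_two ha
    rw [sumStat_neg ha] at h2
    rw [Int.even_iff] at h3
    push_cast at h2
    omega
  · intro h
    exact exists_sumStat_eq_of_even 2 (by rw [Int.even_iff]; omega) (by omega) (by push_cast; omega)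

theorem range_lenB_add_nmaj {n : ℕ} (hn : 2 < n) :
    Set.range (lenB n + nmaj n) =
      ((Finset.Icc (0 : ℤ) (2 * n ^ 2) \ {1, 2 * (n : ℤ) ^ 2 - 1} : Finset ℤ) : Set ℤ) := by
  ext v
  rw [mem_range_lenB_add_nmaj]
  simp only [Finset.mem_coe, Finset.mem_sdiff, Finset.mem_Icc, Finset.mem_insert,
    Finset.mem_singleton, not_or]
  constructor
  · rintro ⟨a, ha, rfl⟩
    have h1 := sumStat_nonneg a
    have h2 := sumStat_nonneg (-a)
    have h3 := sumStat_ne_one ha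
    have h4 := sumStat_ne_one ha.neg
    rw [sumStat_neg ha] at h2 h4
    refine ⟨⟨h1, by linarith⟩, h3, fun h => h4 (by linarith)⟩
  · rintro ⟨⟨h1, h2⟩, h3, h4⟩
    rcases Int.even_or_odd v with hv | hv
    · exact exists_sumStat_eq_of_even n hv h1 h2
    · have hv' := hv
      obtain ⟨N, hN⟩ := hv'
      exact exists_sumStat_eq_of_odd hn hv (by omega) (by omega)

end CoxeterStat

theorem mainTheorem8 (n : ℕ) (hn : 2 ≤ n) :
    (Set.range (CoxeterStat.lenB n + CoxeterStat.nmaj n)).ncard =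
        (if n = 2 then 5 else 2 * n ^ 2 - 1) ∧
      Set.range (CoxeterStat.lenB n - CoxeterStat.nmaj n) =
        Set.range (CoxeterStat.lenA n - CoxeterStat.majA n) := by
  refine ⟨?_, CoxeterStat.range_lenB_sub_nmaj n⟩
  split_ifs with h
  · subst h
    rw [CoxeterStat.range_lenB_add_nmaj_two, Set.ncard_coe_finset]
    rfl
  · have h2 : 2 < n := by omega
    have hsq : 9 ≤ n ^ 2 := by nlinarith
    -- This bound makes 1 and 2n² - 1 distinct members of the interval, so exactly two of its 2n² +
    -- 1 integers are removed.
    have hsq' : (9 : ℤ) ≤ (n : ℤ) ^ 2 := by exact_mod_cast hsq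
    rw [CoxeterStat.range_lenB_add_nmaj h2, Set.ncard_coe_finset, Finset.card_sdiff_of_subset,
      Int.card_Icc, Finset.card_pair (by omega)]
    · have : ((2 * (n : ℤ) ^ 2 + 1 - 0).toNat) = 2 * n ^ 2 + 1 := by
        rw [show (2 * (n : ℤ) ^ 2 + 1 - 0) = ((2 * n ^ 2 + 1 : ℕ) : ℤ) by push_cast; ring]
        exact Int.toNat_natCast _
      omega
    · intro x hx
      simp only [Finset.mem_insert, Finset.mem_singleton] at hx
      rw [Finset.mem_Icc]
      omega
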